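/- Let $\Gamma$ be the gamma function and $\psi=\Gamma'/\Gamma$ the di-gamma function on $(0,\infty)$. A positive function $f$ on an interval $I$ is called logarithmically completely monotonic on $I$ if it has derivatives of all orders on $I$ and $0\le(-1)^k[\ln f(x)]^{(k)}<\infty$ for all integers $k\ge1$ and all $x\in I$. Let $s<t$ be real numbers. (1) For every real $\alpha\ge0$, the function $$x\mapsto\frac{\Gamma(x+s)}{\Gamma(x+t)}\cdot\frac{(x+t)^{x+t-1/2}}{(x+s)^{x+s-1/2}}\exp\biggl[s-t+\frac{\psi'(x+t+\alpha)-\psi'(x+s+\alpha)}{12}\biggr]$$ is logarithmically completely monotonic on $(-s,\infty)$ if and only if $\alpha\ge\frac12$, and its reciprocal is logarithmically completely monotonic on $(-s,\infty)$ if and only if $\alpha=0$. (2) For all real $\alpha>\beta\ge0$, the double inequality $$\exp\biggl[t-s+\frac{\psi'(x+s+\alpha)-\psi'(x+t+\alpha)}{12}\biggr]\le\frac{\Gamma(x+s)}{\Gamma(x+t)}\cdot\frac{(x+t)^{x+t-1/2}}{(x+s)^{x+s-1/2}}\le\exp\biggl[t-s+\frac{\psi'(x+s+\beta)-\psi'(x+t+\beta)}{12}\biggr]$$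 holds for all $x\in(-s,\infty)$ if and only if $\beta=0$ and $\alpha\ge\frac12$. -/

import Mathlib

open Set Real
open scoped ContDiff

/-- The di-gamma function `ψ = Γ' / Γ` of a real variable. -/
noncomputable def psi : ℝ → ℝ := logDeriv Real.Gamma

/-- The tri-gamma function `ψ'` of a real variable. -/
noncomputable def trigamma : ℝ → ℝ := deriv psi

/-- `f` is logarithmically completely monotonic on the interval `I`: it is positive (so that `ln f`
makes sense), has derivatives of all orders on `I`, and `0 ≤ (-1)^k [ln f(x)]^{(k)}` for all integers
`k ≥ 1` and all `x ∈ I`. Finiteness of the derivatives is automatic for real values. -/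
def IsLogCompletelyMonotonicOn (f : ℝ → ℝ) (I : Set ℝ) : Prop :=
  (∀ x ∈ I, 0 < f x) ∧ ContDiffOn ℝ ∞ f I ∧
    ∀ k : ℕ, 1 ≤ k → ∀ x ∈ I, 0 ≤ (-1 : ℝ) ^ k * iteratedDerivWithin k (fun y => Real.log (f y)) I x

/-- `Γ(x+s)/Γ(x+t) · (x+t)^{x+t-1/2} / (x+s)^{x+s-1/2}`. -/
noncomputable def gammaRatio (s t x : ℝ) : ℝ :=
  Real.Gamma (x + s) / Real.Gamma (x + t) *
    ((x + t) ^ (x + t - 1 / 2) / (x + s) ^ (x + s - 1 / 2))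

/-- The ratio above times `exp [s - t + (ψ'(x+t+α) - ψ'(x+s+α)) / 12]`. -/
noncomputable def gammaRatioExp (s t α x : ℝ) : ℝ :=
  gammaRatio s t x * Real.exp (s - t + (trigamma (x + t + α) - trigamma (x + s + α)) / 12)

open Filter Topology

/-! Let `R` be the Stirling remainder `stirlingRem α`. The logarithm of the function in (1) is `R (x
+ s) - R (x + t)`, and (2) compares `R` at the same two points, so everything reduces to the
monotonicity of `R` and of its signed derivatives.

Sufficiency: up to the factor `(-1) ^ m * m!`, the derivative of order `m + 2` is a function `H`
tending to 0 at infinity. The difference `H x - H (x + 1)` is the trapezoidal error on `[x, x + 1]`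
for `φ y = (m + 1) / y ^ (m + 2)`, minus `φ'' (x + α) / 12`. That error lies between `φ'' (x + 1 /
2) / 12` and `φ'' x / 12`, so telescoping gives `H ≥ 0` for `α ≥ 1 / 2` and `H ≤ 0` for `α = 0`.

Necessity: for `α < 1 / 2` the second derivative of `R` is negative far out
(`stirlingRemHigher_zero_neg`); for `α > 0`, `R` tends to `+∞` at `0`
(`tendsto_stirlingRem_nhdsGT_zero`), which rules out the opposite inequality near `-s`. -/

/-! ### Inverse powers and their shifted sums -/

theorem hasDerivAt_inv_add_pow (k : ℕ) {c x : ℝ} (hx : 0 < x + c) :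
    HasDerivAt (fun y => ((y + c) ^ k)⁻¹) (-(k * ((x + c) ^ (k + 1))⁻¹)) x := by
  have h := (((hasDerivAt_id x).add_const c).pow k).inv (by simpa using (pow_pos hx k).ne')
  refine h.congr_deriv ?_
  rcases k with _ | k
  · simp
  · have := hx.ne'
    simp only [id]
    push_cast
    simp only [Pi.pow_apply]
    field_simp
    ring

theorem hasDerivAt_inv_pow (k : ℕ) {x : ℝ} (hx : 0 < x) :
    HasDerivAt (fun y : ℝ => (y ^ k)⁻¹) (-(k * (x ^ (k + 1))⁻¹)) x := by
  simpa using hasDerivAt_inv_add_pow k (c := 0) (by simpa using hx)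

theorem antitoneOn_inv_pow (k : ℕ) : AntitoneOn (fun y : ℝ => (y ^ k)⁻¹) (Ioi 0) := by
  intro a ha b _ hab
  have ha' : (0 : ℝ) < a := ha
  dsimp only
  gcongr

/-- The series `∑ 1 / (x + n) ^ k`, a Hurwitz zeta value at a positive integer. -/
noncomputable def invPowSum (k : ℕ) (x : ℝ) : ℝ := ∑' n : ℕ, ((x + n) ^ k)⁻¹

theorem summable_inv_add_pow {k : ℕ} (hk : 2 ≤ k) {x : ℝ} (hx : 0 < x) :
    Summable fun n : ℕ => ((x + n) ^ k)⁻¹ := by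
  have h := (Real.summable_one_div_nat_add_rpow x k).2 (by exact_mod_cast hk)
  refine h.congr fun n => ?_
  rw [abs_of_pos (by positivity), Real.rpow_natCast, one_div, add_comm]

theorem antitoneOn_invPowSum {k : ℕ} (hk : 2 ≤ k) : AntitoneOn (invPowSum k) (Ioi 0) := by
  intro a ha b hb hab
  have ha' : (0 : ℝ) < a := ha
  refine (summable_inv_add_pow hk hb).tsum_le_tsum (fun n => ?_) (summable_inv_add_pow hk ha)
  gcongr

theorem invPowSum_add_one {k : ℕ} (hk : 2 ≤ k) {x : ℝ} (hx : 0 < x) :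
    invPowSum k (x + 1) = invPowSum k x - (x ^ k)⁻¹ := by
  unfold invPowSum
  rw [(summable_inv_add_pow hk hx).tsum_eq_zero_add]
  simp only [Nat.cast_add, Nat.cast_one, Nat.cast_zero, add_zero, add_sub_cancel_left]
  exact tsum_congr fun n => by rw [add_right_comm, add_assoc]

theorem hasDerivAt_invPowSum {k : ℕ} (hk : 2 ≤ k) {x : ℝ} (hx : 0 < x) :
    HasDerivAt (invPowSum k) (-(k * invPowSum (k + 1) x)) x := by
  -- On `(x / 2, ∞)` the differentiated series is dominated by its values at `x / 2`.
  have hx2 : 0 < x / 2 := by positivity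
  have h := hasDerivAt_tsum_of_isPreconnected (t := Ioi (x / 2)) (y₀ := x) (y := x)
    (g := fun (n : ℕ) (y : ℝ) => ((y + n) ^ k)⁻¹)
    (g' := fun (n : ℕ) (y : ℝ) => -(k * ((y + n) ^ (k + 1))⁻¹))
    (u := fun n : ℕ => k * ((x / 2 + n) ^ (k + 1))⁻¹)
    ((summable_inv_add_pow (by omega) hx2).mul_left _) isOpen_Ioi isPreconnected_Ioi
    (fun n y hy => hasDerivAt_inv_add_pow k (by
      have : x / 2 < y := hy
      have : 0 < y := by linarith
      positivity))
    (fun n y hy => by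
      have h1 : x / 2 < y := hy
      have : 0 < y := by linarith
      rw [norm_neg, Real.norm_of_nonneg (by positivity)]
      gcongr)
    (by simp only [mem_Ioi]; linarith) (summable_inv_add_pow hk hx) (by simp only [mem_Ioi]; linarith)
  rw [tsum_neg, tsum_mul_left] at h
  exact h

theorem tendsto_invPowSum {k : ℕ} (hk : 2 ≤ k) : Tendsto (invPowSum k) atTop (𝓝 0) := by
  have h := tendsto_tsum_of_dominated_convergence (𝓕 := atTop)
    (f := fun (x : ℝ) (n : ℕ) => ((x + n) ^ k)⁻¹) (g := fun _ => (0 : ℝ))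
    (bound := fun n : ℕ => ((1 + n : ℝ) ^ k)⁻¹) (summable_inv_add_pow hk one_pos)
    (fun n => ((tendsto_pow_atTop (by omega)).comp
      (tendsto_atTop_add_const_right _ _ tendsto_id)).inv_tendsto_atTop)
    (by
      filter_upwards [eventually_ge_atTop 1] with x hx n
      rw [Real.norm_of_nonneg (by positivity)]
      gcongr)
  rwa [tsum_zero] at h

theorem tendsto_inv_pow {k : ℕ} (hk : k ≠ 0) :
    Tendsto (fun x : ℝ => (x ^ k)⁻¹) atTop (𝓝 0) :=
  (tendsto_pow_atTop hk).inv_tendsto_atTop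

/-- A function tending to `0` at infinity that does not increase under unit shifts is nonnegative. -/
theorem nonneg_of_add_one_le {f : ℝ → ℝ} {a : ℝ} (hf : ∀ x, a < x → f (x + 1) ≤ f x)
    (h0 : Tendsto f atTop (𝓝 0)) {x : ℝ} (hx : a < x) : 0 ≤ f x := by
  have hanti : Antitone fun n : ℕ => f (x + n) := antitone_nat_of_succ_le fun n => by
    have := hf (x + n) (by have : (0 : ℝ) ≤ n := n.cast_nonneg
                           linarith)
    simpa [add_assoc] using this
  have hlim : Tendsto (fun n : ℕ => f (x + n)) atTop (𝓝 0) :=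
    h0.comp (tendsto_atTop_add_const_left _ _ tendsto_natCast_atTop_atTop)
  simpa using hanti.le_of_tendsto hlim 0

/-! ### Two-sided error bounds for the trapezoidal rule -/

section Trapezoid

variable {A φ φ₁ φ₂ : ℝ → ℝ}

/-- Upper bound for the error of the trapezoidal rule. -/
theorem trapezoid_error_le (hA : ∀ y, 0 < y → HasDerivAt A (φ y) y)
    (hφ : ∀ y, 0 < y → HasDerivAt φ (φ₁ y) y) (hφ₁ : ∀ y, 0 < y → HasDerivAt φ₁ (φ₂ y) y)
    (h₂ : AntitoneOn φ₂ (Ioi 0)) {x : ℝ} (hx : 0 < x) :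
    (φ x + φ (x + 1)) / 2 - (A (x + 1) - A x) ≤ φ₂ x / 12 := by
  have shift : ∀ {f f' : ℝ → ℝ}, (∀ y, 0 < y → HasDerivAt f (f' y) y) → ∀ h, 0 ≤ h →
      HasDerivAt (fun h => f (x + h)) (f' (x + h)) h := fun hf h hh =>
    (hf (x + h) (by linarith)).comp_const_add x h
  -- The error on `[x, x + h]` minus `h ^ 3 / 12 * φ₂ x` vanishes to first order at `h = 0`, and its
  -- second derivative is nonpositive because `φ₂` decreases.
  have hE' : ∀ h, 0 ≤ h → HasDerivAt
      (fun h => (φ x - φ (x + h)) / 2 + h / 2 * φ₁ (x + h) - h ^ 2 / 4 * φ₂ x)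
      (h / 2 * (φ₂ (x + h) - φ₂ x)) h := fun h hh => by
    have := ((((shift hφ h hh).const_sub (φ x)).div_const 2).add
      (((hasDerivAt_id h).div_const 2).mul (shift hφ₁ h hh))).sub
      (((hasDerivAt_pow 2 h).div_const 4).mul_const (φ₂ x))
    refine this.congr_deriv ?_
    simp only [id]; push_cast; ring
  have hE : ∀ h, 0 ≤ h → HasDerivAt
      (fun h => h / 2 * (φ x + φ (x + h)) - (A (x + h) - A x) - h ^ 3 / 12 * φ₂ x)
      ((φ x - φ (x + h)) / 2 + h / 2 * φ₁ (x + h) - h ^ 2 / 4 * φ₂ x) h := fun h hh => by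
    have := (((((hasDerivAt_id h).div_const 2).mul ((shift hφ h hh).const_add (φ x)))).sub
      ((shift hA h hh).sub_const (A x))).sub
      (((hasDerivAt_pow 3 h).div_const 12).mul_const (φ₂ x))
    refine this.congr_deriv ?_
    simp only [id]; push_cast; ring
  have key : ∀ {f f' : ℝ → ℝ}, (∀ h, 0 ≤ h → HasDerivAt f (f' h) h) → (∀ h, 0 ≤ h → f' h ≤ 0) →
      ∀ h, 0 ≤ h → f h ≤ f 0 := by
    intro f f' hf hf' h hh
    refine antitoneOn_of_hasDerivWithinAt_nonpos (convex_Ici 0)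
      (fun y hy => (hf y hy).continuousAt.continuousWithinAt)
      (fun y hy => (hf y (interior_subset hy)).hasDerivWithinAt)
      (fun y hy => hf' y (interior_subset hy)) (mem_Ici.2 le_rfl) hh hh
  have h1 := key hE' fun h hh => mul_nonpos_of_nonneg_of_nonpos (by positivity)
    (sub_nonpos.2 (h₂ hx (by simp only [mem_Ioi]; linarith) (by linarith)))
  have h2 := key hE (fun h hh => (h1 h hh).trans (by simp)) 1 zero_le_one
  simp only [add_zero] at h2
  linarith

/-- Lower bound for the error of the trapezoidal rule. -/
theorem le_trapezoid_error (hA : ∀ y, 0 < y → HasDerivAt A (φ y) y)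
    (hφ : ∀ y, 0 < y → HasDerivAt φ (φ₁ y) y) (hφ₁ : ∀ y, 0 < y → HasDerivAt φ₁ (φ₂ y) y)
    (h₂ : ConvexOn ℝ (Ioi 0) φ₂) {x : ℝ} (hx : 0 < x) :
    φ₂ (x + 1 / 2) / 12 ≤ (φ x + φ (x + 1)) / 2 - (A (x + 1) - A x) := by
  -- The interval grows symmetrically from its midpoint, so that convexity of `φ₂` enters as `2 φ₂ c
  -- ≤ φ₂ (c + h) + φ₂ (c - h)`.
  set c := x + 1 / 2 with hc
  have add : ∀ {f f' : ℝ → ℝ}, (∀ y, 0 < y → HasDerivAt f (f' y) y) → ∀ h ∈ Icc (0 : ℝ) (1 / 2),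
      HasDerivAt (fun h => f (c + h)) (f' (c + h)) h := fun hf h hh =>
    (hf (c + h) (by linarith [hh.1])).comp_const_add c h
  have sub : ∀ {f f' : ℝ → ℝ}, (∀ y, 0 < y → HasDerivAt f (f' y) y) → ∀ h ∈ Icc (0 : ℝ) (1 / 2),
      HasDerivAt (fun h => f (c - h)) (-f' (c - h)) h := fun hf h hh =>
    (hf (c - h) (by linarith [hh.2])).comp_const_sub c h
  have key : ∀ {f f' : ℝ → ℝ}, (∀ h ∈ Icc (0 : ℝ) (1 / 2), HasDerivAt f (f' h) h) →
      (∀ h ∈ Icc (0 : ℝ) (1 / 2), 0 ≤ f' h) → ∀ h ∈ Icc (0 : ℝ) (1 / 2), f 0 ≤ f h := by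
    intro f f' hf hf' h hh
    refine monotoneOn_of_hasDerivWithinAt_nonneg (convex_Icc 0 (1 / 2))
      (fun y hy => (hf y hy).continuousAt.continuousWithinAt)
      (fun y hy => (hf y (interior_subset hy)).hasDerivWithinAt)
      (fun y hy => hf' y (interior_subset hy)) ⟨le_rfl, by norm_num⟩ hh hh.1
  have hE' : ∀ h ∈ Icc (0 : ℝ) (1 / 2), HasDerivAt
      (fun h => φ₁ (c + h) - φ₁ (c - h) - 2 * h * φ₂ c)
      (φ₂ (c + h) + φ₂ (c - h) - 2 * φ₂ c) h := fun h hh => by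
    have := ((add hφ₁ h hh).sub (sub hφ₁ h hh)).sub
      (((hasDerivAt_id h).const_mul 2).mul_const (φ₂ c))
    refine this.congr_deriv ?_
    ring
  have hE : ∀ h ∈ Icc (0 : ℝ) (1 / 2), HasDerivAt
      (fun h => h * (φ (c + h) + φ (c - h)) - (A (c + h) - A (c - h)) - 2 * h ^ 3 / 3 * φ₂ c)
      (h * (φ₁ (c + h) - φ₁ (c - h) - 2 * h * φ₂ c)) h := fun h hh => by
    have := (((hasDerivAt_id h).mul ((add hφ h hh).add (sub hφ h hh))).sub
      ((add hA h hh).sub (sub hA h hh))).sub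
      ((((hasDerivAt_pow 3 h).const_mul 2).div_const 3).mul_const (φ₂ c))
    refine this.congr_deriv ?_
    simp only [id, Pi.add_apply]; push_cast; ring
  have h1 := key hE' fun h hh => by
    have := h₂.2 (x := c + h) (y := c - h) (by simp only [mem_Ioi]; linarith [hh.1])
      (by simp only [mem_Ioi]; linarith [hh.2])
      (by norm_num : (0 : ℝ) ≤ 1 / 2) (by norm_num : (0 : ℝ) ≤ 1 / 2) (by norm_num)
    simp only [smul_eq_mul] at this
    rw [show 1 / 2 * (c + h) + 1 / 2 * (c - h) = c by ring] at this
    linarith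
  have h2 := key hE (fun h hh => mul_nonneg hh.1 (le_trans (by simp) (h1 h hh))) (1 / 2)
    ⟨by norm_num, le_rfl⟩
  simp only [add_zero, sub_zero] at h2
  rw [show c + 1 / 2 = x + 1 by rw [hc]; ring, show c - 1 / 2 = x by rw [hc]; ring] at h2
  linarith

end Trapezoid

/-! ### The digamma function and the series for its derivative -/

theorem hasDerivAt_log_Gamma {x : ℝ} (hx : 0 < x) :
    HasDerivAt (fun y => log (Gamma y)) (psi x) x := by
  have h : DifferentiableAt ℝ Gamma x := differentiableOn_Gamma_Ioi.differentiableAt (Ioi_mem_nhds hx)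
  exact h.hasDerivAt.log (Gamma_pos_of_pos hx).ne'

theorem log_Gamma_add_one {x : ℝ} (hx : 0 < x) :
    log (Gamma (x + 1)) = log x + log (Gamma x) := by
  rw [Gamma_add_one hx.ne', log_mul hx.ne' (Gamma_pos_of_pos hx).ne']

theorem psi_add_one {x : ℝ} (hx : 0 < x) : psi (x + 1) = psi x + x⁻¹ := by
  have h1 := (hasDerivAt_log_Gamma (x := x + 1) (by linarith)).comp_add_const x 1
  have h2 := (hasDerivAt_log hx.ne').add (hasDerivAt_log_Gamma hx)
  have h3 : (fun y => log (Gamma (y + 1))) =ᶠ[𝓝 x] (fun y => log y + log (Gamma y)) := by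
    filter_upwards [Ioi_mem_nhds hx] with y hy using log_Gamma_add_one hy
  rw [h1.unique (h2.congr_of_eventuallyEq h3), add_comm]

theorem monotoneOn_psi : MonotoneOn psi (Ioi 0) := by
  have h := convexOn_log_Gamma.monotoneOn_deriv
    fun x hx => (hasDerivAt_log_Gamma hx).differentiableAt
  exact h.congr fun x hx => (hasDerivAt_log_Gamma hx).deriv

/-- The slope of the convex function `log Γ` over `[x, x + 1]` is exactly `log x`, so it lies
between `ψ x` and `ψ (x + 1)`. -/
theorem psi_le_log {x : ℝ} (hx : 0 < x) : psi x ≤ log x := by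
  have h := convexOn_log_Gamma.le_slope_of_hasDerivAt (y := x + 1) hx
    (by simp only [mem_Ioi]; linarith) (by linarith) (hasDerivAt_log_Gamma hx)
  simpa [slope_def_field, log_Gamma_add_one hx] using h

theorem log_le_psi_add_inv {x : ℝ} (hx : 0 < x) : log x ≤ psi x + x⁻¹ := by
  have hx1 : (0 : ℝ) < x + 1 := by linarith
  have h := convexOn_log_Gamma.slope_le_of_hasDerivAt (x := x) hx hx1
    (by linarith) (hasDerivAt_log_Gamma hx1)
  rw [← psi_add_one hx]
  simpa [slope_def_field, log_Gamma_add_one hx] using h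

/-- The series `∑ (1 / (n + 1) - 1 / (x + n))`. -/
noncomputable def harmonicDiff (x : ℝ) : ℝ := ∑' n : ℕ, ((1 + n : ℝ)⁻¹ - (x + n)⁻¹)

theorem summable_hasDerivAt_harmonicDiff {x : ℝ} (hx : 0 < x) :
    Summable (fun n : ℕ => (1 + n : ℝ)⁻¹ - (x + n)⁻¹) ∧
      HasDerivAt harmonicDiff (invPowSum 2 x) x := by
  -- The half-line `(a, ∞)` must contain `x` and also `1`, where every term of the series vanishes
  -- and convergence is trivial.
  set a := min x 1 / 2 with ha
  have ha0 : 0 < a := by positivity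
  have hax : a < x := by have := min_le_left x 1; have := lt_min hx one_pos; linarith
  have ha1 : a < 1 := by have := min_le_right x 1; linarith
  have hd : ∀ (n : ℕ) (y : ℝ), y ∈ Ioi a →
      HasDerivAt (fun z : ℝ => (1 + n : ℝ)⁻¹ - (z + n)⁻¹) (((y + n) ^ 2)⁻¹) y := fun n y hy => by
    have hy' : a < y := hy
    have hpos : 0 < y + n := by have : (0 : ℝ) ≤ n := n.cast_nonneg; linarith
    simpa using (hasDerivAt_inv_add_pow 1 hpos).const_sub ((1 + n : ℝ)⁻¹)
  have hb : ∀ (n : ℕ) (y : ℝ), y ∈ Ioi a → ‖((y + n) ^ 2)⁻¹‖ ≤ ((a + n) ^ 2)⁻¹ := fun n y hy => by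
    have hy' : a < y := hy
    have hy0 : 0 < y := by linarith
    rw [Real.norm_of_nonneg (by positivity)]
    gcongr
  have hs := summable_inv_add_pow le_rfl ha0
  have h1 : Summable fun n : ℕ => (1 + n : ℝ)⁻¹ - (1 + n : ℝ)⁻¹ := by simp
  exact ⟨summable_of_summable_hasDerivAt_of_isPreconnected hs isOpen_Ioi isPreconnected_Ioi hd hb
    (y₀ := 1) ha1 h1 hax, hasDerivAt_tsum_of_isPreconnected hs isOpen_Ioi isPreconnected_Ioi hd hb
    (y₀ := 1) ha1 h1 hax⟩

theorem monotoneOn_harmonicDiff : MonotoneOn harmonicDiff (Ioi 0) := by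
  intro a ha b hb hab
  have ha' : (0 : ℝ) < a := ha
  refine (summable_hasDerivAt_harmonicDiff ha).1.tsum_le_tsum (fun n => ?_)
    (summable_hasDerivAt_harmonicDiff hb).1
  gcongr

theorem harmonicDiff_add_one {x : ℝ} (hx : 0 < x) :
    harmonicDiff (x + 1) = harmonicDiff x + x⁻¹ := by
  have h0 := (summable_hasDerivAt_harmonicDiff hx).1
  have h1 := (summable_hasDerivAt_harmonicDiff (x := x + 1) (by linarith)).1
  have h := (h1.hasSum.sub h0.hasSum).tendsto_sum_nat
  have h' : Tendsto (fun N : ℕ => ∑ n ∈ Finset.range N,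
      ((1 + n : ℝ)⁻¹ - (x + 1 + n)⁻¹ - ((1 + n : ℝ)⁻¹ - (x + n)⁻¹))) atTop (𝓝 (x⁻¹ - 0)) := by
    have : ∀ N : ℕ, ∑ n ∈ Finset.range N,
        ((1 + n : ℝ)⁻¹ - (x + 1 + n)⁻¹ - ((1 + n : ℝ)⁻¹ - (x + n)⁻¹)) = x⁻¹ - (x + N)⁻¹ := by
      intro N
      have := Finset.sum_range_sub' (fun n : ℕ => (x + n)⁻¹) N
      simp only [Nat.cast_zero, add_zero] at this
      rw [← this]
      refine Finset.sum_congr rfl fun n _ => ?_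
      push_cast
      rw [show x + 1 + n = x + (n + 1) by ring]
      ring
    simp_rw [this]
    exact tendsto_const_nhds.sub
      (tendsto_atTop_add_const_left _ _ tendsto_natCast_atTop_atTop).inv_tendsto_atTop
  have := tendsto_nhds_unique h h'
  unfold harmonicDiff
  linarith

/-- Two monotone solutions of `f (x + 1) = f x + 1 / x` differ by a constant. -/
theorem sub_eq_sub_of_monotoneOn_of_add_one {f g : ℝ → ℝ}
    (hf : MonotoneOn f (Ioi 0)) (hg : MonotoneOn g (Ioi 0))
    (hf1 : ∀ x, 0 < x → f (x + 1) = f x + x⁻¹) (hg1 : ∀ x, 0 < x → g (x + 1) = g x + x⁻¹)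
    {x y : ℝ} (hx : 0 < x) (hxy : x ≤ y) (hy : y ≤ x + 1) : f y - g y = f x - g x := by
  have hper : ∀ z, 0 < z → ∀ N : ℕ, f (z + N) - g (z + N) = f z - g z := by
    intro z hz N
    induction N with
    | zero => simp
    | succ N ih =>
      have hzN : 0 < z + N := by positivity
      rw [Nat.cast_succ, ← add_assoc, hf1 _ hzN, hg1 _ hzN, ← ih]
      ring
  -- Both functions rise by exactly `(x + N)⁻¹` over `[x + N, x + N + 1]`, so monotonicity confines
  -- both increments to that range.
  have hbd : ∀ N : ℕ, |f y - g y - (f x - g x)| ≤ (x + N)⁻¹ := by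
    intro N
    have hxN : 0 < x + N := by positivity
    have hyN : 0 < y + N := by linarith
    have hxN1 : 0 < x + N + 1 := by linarith
    rw [← hper x hx N, ← hper y (by linarith) N]
    have a1 := hf hxN hyN (by linarith)
    have a2 := hf hyN hxN1 (by linarith)
    have b1 := hg hxN hyN (by linarith)
    have b2 := hg hyN hxN1 (by linarith)
    rw [hf1 _ hxN] at a2
    rw [hg1 _ hxN] at b2
    rw [abs_le]
    constructor <;> linarith
  have hlim : Tendsto (fun N : ℕ => (x + N)⁻¹) atTop (𝓝 0) :=
    (tendsto_atTop_add_const_left _ _ tendsto_natCast_atTop_atTop).inv_tendsto_atTop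
  have := ge_of_tendsto' hlim hbd
  exact sub_eq_zero.1 (abs_nonpos_iff.1 this)

/-- As in the Bohr–Mollerup argument, monotonicity and the functional equation force `psi -
harmonicDiff` to be locally constant, and the series can be differentiated termwise. -/
theorem hasDerivAt_psi {x : ℝ} (hx : 0 < x) : HasDerivAt psi (invPowSum 2 x) x := by
  refine ((summable_hasDerivAt_harmonicDiff hx).2.add_const
    (psi x - harmonicDiff x)).congr_of_eventuallyEq ?_
  have huniq := @sub_eq_sub_of_monotoneOn_of_add_one psi harmonicDiff monotoneOn_psi
    monotoneOn_harmonicDiff (fun _ => psi_add_one) fun _ => harmonicDiff_add_one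
  filter_upwards [Ioo_mem_nhds (show max 0 (x - 1) < x from max_lt hx (by linarith))
    (show x < x + 1 by linarith)] with y hy
  have hy0 : 0 < y := (le_max_left _ _).trans_lt hy.1
  have hy1 : x - 1 < y := (le_max_right _ _).trans_lt hy.1
  rcases le_total x y with h | h
  · have := huniq hx h hy.2.le
    linarith
  · have := huniq hy0 h (by linarith)
    linarith

theorem trigamma_eq {x : ℝ} (hx : 0 < x) : trigamma x = invPowSum 2 x := (hasDerivAt_psi hx).deriv

/-! ### The Stirling remainder and its derivatives -/

/-- The remainder in Stirling's formula (up to a constant), corrected by `ψ' (x + α) / 12`. -/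
noncomputable def stirlingRem (α x : ℝ) : ℝ :=
  log (Gamma x) - (x - 1 / 2) * log x + x - invPowSum 2 (x + α) / 12

/-- The first derivative of `stirlingRem α`. -/
noncomputable def stirlingRemDeriv (α x : ℝ) : ℝ :=
  psi x - log x + x⁻¹ / 2 + invPowSum 3 (x + α) / 6

/-- The derivative of order `m + 2` of `stirlingRem α`, divided by `(-1) ^ m * m!`. -/
noncomputable def stirlingRemHigher (α : ℝ) (m : ℕ) (x : ℝ) : ℝ :=
  (m + 1) * invPowSum (m + 2) x - (x ^ (m + 1))⁻¹ - (m + 1) / 2 * (x ^ (m + 2))⁻¹ -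
    (m + 1) * (m + 2) * (m + 3) / 12 * invPowSum (m + 4) (x + α)

theorem hasDerivAt_stirlingRem {α x : ℝ} (hα : 0 ≤ α) (hx : 0 < x) :
    HasDerivAt (stirlingRem α) (stirlingRemDeriv α x) x := by
  have hP := (hasDerivAt_invPowSum (k := 2) le_rfl (x := x + α) (by linarith)).comp_add_const x α
  have := (((hasDerivAt_log_Gamma hx).sub
    (((hasDerivAt_id x).sub_const (1 / 2)).mul (hasDerivAt_log hx.ne'))).add (hasDerivAt_id x)).sub
    (hP.div_const 12)
  refine this.congr_deriv ?_
  have := hx.ne'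
  unfold stirlingRemDeriv
  simp only [id]
  push_cast
  field_simp
  ring

theorem hasDerivAt_stirlingRemDeriv {α x : ℝ} (hα : 0 ≤ α) (hx : 0 < x) :
    HasDerivAt (stirlingRemDeriv α) (stirlingRemHigher α 0 x) x := by
  have hP := (hasDerivAt_invPowSum (k := 3) (by norm_num) (x := x + α) (by linarith)).comp_add_const
    x α
  have := (((hasDerivAt_psi hx).sub (hasDerivAt_log hx.ne')).add
    ((hasDerivAt_inv hx.ne').div_const 2)).add (hP.div_const 6)
  refine this.congr_deriv ?_
  unfold stirlingRemHigher
  norm_num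
  ring

theorem hasDerivAt_stirlingRemHigher {α x : ℝ} (hα : 0 ≤ α) (m : ℕ) (hx : 0 < x) :
    HasDerivAt (stirlingRemHigher α m) (-((m + 1) * stirlingRemHigher α (m + 1) x)) x := by
  have hP := (hasDerivAt_invPowSum (k := m + 4) (by omega) (x := x + α)
    (by linarith)).comp_add_const x α
  have := ((((hasDerivAt_invPowSum (k := m + 2) (by omega) hx).const_mul ((m : ℝ) + 1)).sub
    (hasDerivAt_inv_pow (m + 1) hx)).sub
    ((hasDerivAt_inv_pow (m + 2) hx).const_mul (((m : ℝ) + 1) / 2))).sub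
    (hP.const_mul (((m : ℝ) + 1) * (m + 2) * (m + 3) / 12))
  refine this.congr_deriv ?_
  unfold stirlingRemHigher
  push_cast
  ring_nf

theorem tendsto_stirlingRemHigher (α : ℝ) (m : ℕ) :
    Tendsto (stirlingRemHigher α m) atTop (𝓝 0) := by
  have h := ((((tendsto_invPowSum (k := m + 2) (by omega)).const_mul ((m : ℝ) + 1)).sub
    (tendsto_inv_pow (k := m + 1) (by omega))).sub
    ((tendsto_inv_pow (k := m + 2) (by omega)).const_mul (((m : ℝ) + 1) / 2))).sub
    (((tendsto_invPowSum (k := m + 4) (by omega)).comp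
      (tendsto_atTop_add_const_right _ α tendsto_id)).const_mul
      (((m : ℝ) + 1) * (m + 2) * (m + 3) / 12))
  simp only [mul_zero, sub_zero] at h
  exact h

theorem tendsto_stirlingRemDeriv (α : ℝ) : Tendsto (stirlingRemDeriv α) atTop (𝓝 0) := by
  have h1 : Tendsto (fun x => psi x - log x) atTop (𝓝 0) := by
    refine tendsto_of_tendsto_of_tendsto_of_le_of_le' (g := fun x : ℝ => -x⁻¹)
      (by simpa using (tendsto_inv_atTop_zero (𝕜 := ℝ)).neg) tendsto_const_nhds ?_ ?_
    · filter_upwards [eventually_gt_atTop 0] with x hx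
      linarith [log_le_psi_add_inv hx]
    · filter_upwards [eventually_gt_atTop 0] with x hx
      linarith [psi_le_log hx]
  have h := (h1.add (tendsto_inv_atTop_zero.div_const 2)).add
    (((tendsto_invPowSum (k := 3) (by omega)).comp
      (tendsto_atTop_add_const_right _ α tendsto_id)).div_const 6)
  simp only [zero_div, add_zero] at h
  exact h

/-- The sums telescope. The form matches the trapezoid lemmas with `A = -y ^ -(m + 1)` and `φ = A'`;
the last term is `φ'' (x + α) / 12`. -/
theorem stirlingRemHigher_sub_add_one {α x : ℝ} (hα : 0 ≤ α) (m : ℕ) (hx : 0 < x) :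
    stirlingRemHigher α m x - stirlingRemHigher α m (x + 1) =
      ((m + 1) * (x ^ (m + 2))⁻¹ + (m + 1) * ((x + 1) ^ (m + 2))⁻¹) / 2 -
        (-((x + 1) ^ (m + 1))⁻¹ - -(x ^ (m + 1))⁻¹) -
        (m + 1) * (m + 2) * (m + 3) / 12 * ((x + α) ^ (m + 4))⁻¹ := by
  unfold stirlingRemHigher
  rw [invPowSum_add_one (by omega) hx, add_right_comm x 1 α,
    invPowSum_add_one (by omega) (by linarith)]
  ring

/-! ### Signs of the higher derivatives -/

theorem convexOn_inv_pow (k : ℕ) : ConvexOn ℝ (Ioi 0) fun y : ℝ => (y ^ k)⁻¹ := by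
  simpa using convexOn_zpow (𝕜 := ℝ) (-(k : ℤ))

section

variable (m : ℕ) {x : ℝ}

theorem hasDerivAt_neg_inv_pow (hx : 0 < x) :
    HasDerivAt (fun y : ℝ => -(y ^ (m + 1))⁻¹) ((m + 1) * (x ^ (m + 2))⁻¹) x := by
  refine (hasDerivAt_inv_pow (m + 1) hx).neg.congr_deriv ?_
  push_cast; ring

theorem hasDerivAt_mul_inv_pow_two (hx : 0 < x) :
    HasDerivAt (fun y : ℝ => (m + 1) * (y ^ (m + 2))⁻¹)
      (-((m + 1) * (m + 2) * (x ^ (m + 3))⁻¹)) x := by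
  refine ((hasDerivAt_inv_pow (m + 2) hx).const_mul ((m : ℝ) + 1)).congr_deriv ?_
  push_cast; ring

theorem hasDerivAt_neg_mul_inv_pow_three (hx : 0 < x) :
    HasDerivAt (fun y : ℝ => -((m + 1) * (m + 2) * (y ^ (m + 3))⁻¹))
      ((m + 1) * (m + 2) * (m + 3) * (x ^ (m + 4))⁻¹) x := by
  refine ((hasDerivAt_inv_pow (m + 3) hx).const_mul (((m : ℝ) + 1) * (m + 2))).neg.congr_deriv ?_
  push_cast; ring

end

theorem stirlingRemHigher_half_nonneg (m : ℕ) {x : ℝ} (hx : 0 < x) :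
    0 ≤ stirlingRemHigher (1 / 2) m x := by
  refine nonneg_of_add_one_le (fun y hy => ?_) (tendsto_stirlingRemHigher _ m) hx
  rw [← sub_nonneg, stirlingRemHigher_sub_add_one (by norm_num) m hy]
  have := le_trapezoid_error (fun y hy => hasDerivAt_neg_inv_pow m hy)
    (fun y hy => hasDerivAt_mul_inv_pow_two m hy)
    (fun y hy => hasDerivAt_neg_mul_inv_pow_three m hy)
    ((convexOn_inv_pow (m + 4)).smul (c := ((m : ℝ) + 1) * (m + 2) * (m + 3)) (by positivity)) hy
  linarith

theorem stirlingRemHigher_nonneg {α : ℝ} (hα : 1 / 2 ≤ α) (m : ℕ) {x : ℝ} (hx : 0 < x) :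
    0 ≤ stirlingRemHigher α m x := by
  refine (stirlingRemHigher_half_nonneg m hx).trans ?_
  unfold stirlingRemHigher
  have := antitoneOn_invPowSum (k := m + 4) (by omega) (show 0 < x + 1 / 2 by linarith)
    (show 0 < x + α by linarith) (by linarith)
  gcongr

theorem stirlingRemHigher_zero_nonpos (m : ℕ) {x : ℝ} (hx : 0 < x) :
    stirlingRemHigher 0 m x ≤ 0 := by
  have hlim : Tendsto (fun x => -stirlingRemHigher 0 m x) atTop (𝓝 0) := by
    simpa using (tendsto_stirlingRemHigher 0 m).neg
  refine neg_nonneg.1 (nonneg_of_add_one_le (fun y hy => ?_) hlim hx)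
  have h := stirlingRemHigher_sub_add_one le_rfl m hy
  have := trapezoid_error_le (fun y hy => hasDerivAt_neg_inv_pow m hy)
    (fun y hy => hasDerivAt_mul_inv_pow_two m hy)
    (fun y hy => hasDerivAt_neg_mul_inv_pow_three m hy)
    (fun a ha b hb hab => mul_le_mul_of_nonneg_left (antitoneOn_inv_pow (m + 4) ha hb hab)
      (by positivity)) hy
  rw [add_zero] at h
  linarith

theorem stirlingRemHigher_zero_neg {α : ℝ} (hα : 0 ≤ α) (hα' : α < 1 / 2) :
    ∃ a, 0 < a ∧ ∀ x, a < x → stirlingRemHigher α 0 x < 0 := by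
  have hc : 0 < 1 - 2 * α := by linarith
  -- `(y + α) ^ 2 < y * (y + 1)` amounts to `α ^ 2 < (1 - 2 * α) * y`; the extra `1` keeps the
  -- threshold positive.
  refine ⟨(α ^ 2 + 1) / (1 - 2 * α), by positivity, fun x hx => ?_⟩
  have key : ∀ y, (α ^ 2 + 1) / (1 - 2 * α) < y →
      stirlingRemHigher α 0 y < stirlingRemHigher α 0 (y + 1) := by
    intro y hy
    have hy0 : 0 < y := lt_trans (by positivity) hy
    rw [div_lt_iff₀ hc] at hy
    rw [← sub_neg, stirlingRemHigher_sub_add_one hα 0 hy0]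
    have h1 : (y + α) ^ 2 < y * (y + 1) := by nlinarith
    have h2 : ((y * (y + 1)) ^ 2)⁻¹ < ((y + α) ^ 4)⁻¹ := by
      rw [show (y + α) ^ 4 = ((y + α) ^ 2) ^ 2 by ring]
      gcongr
    -- For `m = 0` the trapezoidal error is half the square of `1 / y - 1 / (y + 1)`.
    have h3 : (y ^ 2)⁻¹ / 2 + ((y + 1) ^ 2)⁻¹ / 2 - (y⁻¹ - (y + 1)⁻¹) =
        ((y * (y + 1)) ^ 2)⁻¹ / 2 := by
      field_simp
      ring
    norm_num
    linarith
  have hlim : Tendsto (fun x => -stirlingRemHigher α 0 x) atTop (𝓝 0) := by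
    simpa using (tendsto_stirlingRemHigher α 0).neg
  -- Telescoping starts at `x + 1`, leaving the first step from `x` to supply strictness.
  have h0 := nonneg_of_add_one_le (f := fun x => -stirlingRemHigher α 0 x)
    (fun y hy => neg_le_neg (key y hy).le) hlim
    (x := x + 1) (hx.trans (by linarith))
  linarith [key x hx]

/-! ### Log-complete monotonicity through explicit derivatives -/

theorem isLogCompletelyMonotonicOn_Ioi_iff {f : ℝ → ℝ} {H : ℕ → ℝ → ℝ} {a : ℝ}
    (hpos : ∀ x ∈ Ioi a, 0 < f x) (hlog : ∀ x ∈ Ioi a, log (f x) = H 0 x)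
    (hH : ∀ k, ∀ x ∈ Ioi a, HasDerivAt (H k) (H (k + 1) x) x) :
    IsLogCompletelyMonotonicOn f (Ioi a) ↔
      ∀ k : ℕ, 1 ≤ k → ∀ x ∈ Ioi a, 0 ≤ (-1 : ℝ) ^ k * H k x := by
  have hder : ∀ k : ℕ, EqOn (iteratedDerivWithin k (fun y => log (f y)) (Ioi a)) (H k) (Ioi a) := by
    intro k
    induction k with
    | zero => intro x hx; simpa using hlog x hx
    | succ k ih =>
      intro x hx
      rw [iteratedDerivWithin_succ, derivWithin_congr ih (ih hx)]
      exact (hH k x hx).hasDerivWithinAt.derivWithin (uniqueDiffOn_Ioi a x hx)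
  have hsmooth : ContDiffOn ℝ ∞ f (Ioi a) := by
    have h : ContDiffOn ℝ ∞ (fun y => log (f y)) (Ioi a) :=
      contDiffOn_of_differentiableOn_deriv fun m _ => DifferentiableOn.congr
        (fun x hx => (hH m x hx).differentiableAt.differentiableWithinAt) (hder m)
    exact h.exp.congr fun x hx => (exp_log (hpos x hx)).symm
  refine ⟨fun h k hk x hx => ?_, fun h => ⟨hpos, hsmooth, fun k hk x hx => ?_⟩⟩
  · rw [← hder k hx]
    exact h.2.2 k hk x hx
  · rw [hder k hx]
    exact h k hk x hx

/-- The derivatives of `stirlingRem α`. -/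
noncomputable def stirlingRemIterDeriv (α : ℝ) : ℕ → ℝ → ℝ
  | 0 => stirlingRem α
  | 1 => stirlingRemDeriv α
  | m + 2 => fun x => (-1) ^ m * m.factorial * stirlingRemHigher α m x

theorem hasDerivAt_stirlingRemIterDeriv {α x : ℝ} (hα : 0 ≤ α) (hx : 0 < x) : ∀ k,
    HasDerivAt (stirlingRemIterDeriv α k) (stirlingRemIterDeriv α (k + 1) x) x
  | 0 => hasDerivAt_stirlingRem hα hx
  | 1 => by simpa [stirlingRemIterDeriv] using hasDerivAt_stirlingRemDeriv hα hx
  | m + 2 => by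
    refine ((hasDerivAt_stirlingRemHigher hα m hx).const_mul
      ((-1 : ℝ) ^ m * m.factorial)).congr_deriv ?_
    simp only [stirlingRemIterDeriv, Nat.factorial_succ]
    push_cast
    ring

/-! ### Monotonicity and boundary behaviour of the remainder -/

theorem antitoneOn_Ioi_of_hasDerivAt {f f' : ℝ → ℝ} {a : ℝ}
    (hf : ∀ x, a < x → HasDerivAt f (f' x) x) (hf' : ∀ x, a < x → f' x ≤ 0) :
    AntitoneOn f (Ioi a) :=
  antitoneOn_of_hasDerivWithinAt_nonpos (convex_Ioi a)
    (fun x hx => (hf x hx).continuousAt.continuousWithinAt)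
    (fun x hx => (hf x (interior_subset hx)).hasDerivWithinAt)
    (fun x hx => hf' x (interior_subset hx))

theorem monotoneOn_Ioi_of_hasDerivAt {f f' : ℝ → ℝ} {a : ℝ}
    (hf : ∀ x, a < x → HasDerivAt f (f' x) x) (hf' : ∀ x, a < x → 0 ≤ f' x) :
    MonotoneOn f (Ioi a) :=
  monotoneOn_of_hasDerivWithinAt_nonneg (convex_Ioi a)
    (fun x hx => (hf x hx).continuousAt.continuousWithinAt)
    (fun x hx => (hf x (interior_subset hx)).hasDerivWithinAt)
    (fun x hx => hf' x (interior_subset hx))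

theorem strictMonoOn_Ioi_of_hasDerivAt {f f' : ℝ → ℝ} {a : ℝ}
    (hf : ∀ x, a < x → HasDerivAt f (f' x) x) (hf' : ∀ x, a < x → 0 < f' x) :
    StrictMonoOn f (Ioi a) :=
  strictMonoOn_of_hasDerivWithinAt_pos (convex_Ioi a)
    (fun x hx => (hf x hx).continuousAt.continuousWithinAt)
    (fun x hx => (hf x (interior_subset hx)).hasDerivWithinAt)
    (fun x hx => hf' x (interior_subset hx))

theorem strictAntiOn_Ioi_of_hasDerivAt {f f' : ℝ → ℝ} {a : ℝ}
    (hf : ∀ x, a < x → HasDerivAt f (f' x) x) (hf' : ∀ x, a < x → f' x < 0) :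
    StrictAntiOn f (Ioi a) :=
  strictAntiOn_of_hasDerivWithinAt_neg (convex_Ioi a)
    (fun x hx => (hf x hx).continuousAt.continuousWithinAt)
    (fun x hx => (hf x (interior_subset hx)).hasDerivWithinAt)
    (fun x hx => hf' x (interior_subset hx))

theorem neg_one_pow_mul_self_mul (m : ℕ) (c r : ℝ) : (-1) ^ (m + 2) * ((-1) ^ m * c * r) = c * r := by
  have : ((-1 : ℝ) ^ m) * (-1) ^ m = 1 := by rw [← mul_pow]; norm_num
  linear_combination c * r * this

theorem antitoneOn_neg_one_pow_mul_stirlingRemIterDeriv {α : ℝ} (hα : 1 / 2 ≤ α) {k : ℕ}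
    (hk : 1 ≤ k) : AntitoneOn (fun x => (-1) ^ k * stirlingRemIterDeriv α k x) (Ioi 0) := by
  obtain ⟨m, rfl⟩ := Nat.exists_eq_add_of_le' hk
  refine antitoneOn_Ioi_of_hasDerivAt (fun x hx =>
    (hasDerivAt_stirlingRemIterDeriv (by linarith) hx (m + 1)).const_mul _) fun x hx => ?_
  have h := neg_one_pow_mul_self_mul m m.factorial (stirlingRemHigher α m x)
  have h' : 0 ≤ m.factorial * stirlingRemHigher α m x :=
    mul_nonneg (by positivity) (stirlingRemHigher_nonneg hα m hx)
  simp only [stirlingRemIterDeriv]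
  rw [pow_succ] at h
  linarith

theorem monotoneOn_neg_one_pow_mul_stirlingRemIterDeriv {k : ℕ} (hk : 1 ≤ k) :
    MonotoneOn (fun x => (-1) ^ k * stirlingRemIterDeriv 0 k x) (Ioi 0) := by
  obtain ⟨m, rfl⟩ := Nat.exists_eq_add_of_le' hk
  refine monotoneOn_Ioi_of_hasDerivAt (fun x hx =>
    (hasDerivAt_stirlingRemIterDeriv le_rfl hx (m + 1)).const_mul _) fun x hx => ?_
  have h := neg_one_pow_mul_self_mul m m.factorial (stirlingRemHigher 0 m x)
  have h' : m.factorial * stirlingRemHigher 0 m x ≤ 0 :=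
    mul_nonpos_of_nonneg_of_nonpos (by positivity) (stirlingRemHigher_zero_nonpos m hx)
  simp only [stirlingRemIterDeriv]
  rw [pow_succ] at h
  linarith

/-- The first derivative increases to its limit `0`, hence is nonpositive. This is the order-zero
case needed for the double inequality. -/
theorem antitoneOn_stirlingRem {α : ℝ} (hα : 1 / 2 ≤ α) : AntitoneOn (stirlingRem α) (Ioi 0) := by
  have hα0 : 0 ≤ α := by linarith
  have hmono : MonotoneOn (stirlingRemDeriv α) (Ioi 0) := monotoneOn_Ioi_of_hasDerivAt
    (fun x => hasDerivAt_stirlingRemDeriv hα0) fun x => stirlingRemHigher_nonneg hα 0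
  refine antitoneOn_Ioi_of_hasDerivAt (fun x => hasDerivAt_stirlingRem hα0) fun x hx => ?_
  refine ge_of_tendsto (tendsto_stirlingRemDeriv α) ?_
  filter_upwards [eventually_ge_atTop x] with y hy
  exact hmono hx (hx.trans_le hy) hy

theorem monotoneOn_stirlingRem_zero : MonotoneOn (stirlingRem 0) (Ioi 0) := by
  have hanti : AntitoneOn (stirlingRemDeriv 0) (Ioi 0) := antitoneOn_Ioi_of_hasDerivAt
    (fun x => hasDerivAt_stirlingRemDeriv le_rfl) fun x => stirlingRemHigher_zero_nonpos 0
  refine monotoneOn_Ioi_of_hasDerivAt (fun x => hasDerivAt_stirlingRem le_rfl) fun x hx => ?_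
  refine le_of_tendsto (tendsto_stirlingRemDeriv 0) ?_
  filter_upwards [eventually_ge_atTop x] with y hy
  exact hanti hx (hx.trans_le hy) hy

theorem exists_strictAntiOn_strictMonoOn_stirlingRem {α : ℝ} (hα : 0 ≤ α) (hα' : α < 1 / 2) :
    ∃ a, 0 < a ∧ StrictAntiOn (stirlingRemDeriv α) (Ioi a) ∧
      StrictMonoOn (stirlingRem α) (Ioi a) := by
  obtain ⟨a, ha, h⟩ := stirlingRemHigher_zero_neg hα hα'
  have hanti : StrictAntiOn (stirlingRemDeriv α) (Ioi a) := strictAntiOn_Ioi_of_hasDerivAt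
    (fun x hx => hasDerivAt_stirlingRemDeriv hα (ha.trans hx)) h
  refine ⟨a, ha, hanti, strictMonoOn_Ioi_of_hasDerivAt
    (fun x hx => hasDerivAt_stirlingRem hα (ha.trans hx)) fun x hx => ?_⟩
  have hx1 : a < x + 1 := by linarith
  refine lt_of_le_of_lt (le_of_tendsto (tendsto_stirlingRemDeriv α) ?_)
    (hanti hx hx1 (by linarith))
  filter_upwards [eventually_gt_atTop (x + 1)] with y hy
  exact (hanti hx1 (hx1.trans hy) hy).le

/-- Writing `log Γ(x) = log Γ(x + 1) - log x` leaves `-(1 / 2) * log x` as the only singular term,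
since `ψ' (x + α)` stays finite when `α > 0`. -/
theorem tendsto_stirlingRem_nhdsGT_zero {α : ℝ} (hα : 0 < α) :
    Tendsto (stirlingRem α) (𝓝[>] 0) atTop := by
  have hc : ContinuousAt (fun x => log (Gamma (x + 1)) - x * log x + x -
      invPowSum 2 (x + α) / 12) 0 := by
    refine ContinuousAt.sub (ContinuousAt.add (ContinuousAt.sub ?_ ?_) continuousAt_id)
      (ContinuousAt.div_const ?_ _)
    · exact ((hasDerivAt_log_Gamma (x := 0 + 1) (by norm_num)).comp_add_const 0 1).continuousAt
    · exact continuous_mul_log.continuousAt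
    · exact ((hasDerivAt_invPowSum le_rfl (x := 0 + α) (by linarith)).comp_add_const 0 α).continuousAt
  have hlog : Tendsto (fun x => -(1 / 2) * log x) (𝓝[>] 0) atTop :=
    tendsto_log_nhdsGT_zero.const_mul_atBot_of_neg (by norm_num)
  refine ((hc.tendsto.mono_left nhdsWithin_le_nhds).add_atTop hlog).congr' ?_
  filter_upwards [self_mem_nhdsWithin] with x hx
  rw [log_Gamma_add_one hx]
  unfold stirlingRem
  ring

/-! ### The gamma ratio expressed by the remainder -/

variable {s t α β x : ℝ}

theorem gammaRatio_pos (hs : 0 < x + s) (ht : 0 < x + t) : 0 < gammaRatio s t x := by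
  have h1 := Gamma_pos_of_pos hs
  have h2 := Gamma_pos_of_pos ht
  unfold gammaRatio
  positivity

theorem gammaRatioExp_pos (hs : 0 < x + s) (ht : 0 < x + t) : 0 < gammaRatioExp s t α x :=
  mul_pos (gammaRatio_pos hs ht) (exp_pos _)

theorem log_gammaRatio (hs : 0 < x + s) (ht : 0 < x + t) :
    log (gammaRatio s t x) = log (Gamma (x + s)) - log (Gamma (x + t)) +
      ((x + t - 1 / 2) * log (x + t) - (x + s - 1 / 2) * log (x + s)) := by
  have h1 := (Gamma_pos_of_pos hs).ne'
  have h2 := (Gamma_pos_of_pos ht).ne'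
  have h3 := (rpow_pos_of_pos hs (x + s - 1 / 2)).ne'
  have h4 := (rpow_pos_of_pos ht (x + t - 1 / 2)).ne'
  rw [gammaRatio, log_mul (div_ne_zero h1 h2) (div_ne_zero h4 h3), log_div h1 h2, log_div h4 h3,
    log_rpow hs, log_rpow ht]

theorem log_gammaRatioExp (hα : 0 ≤ α) (hs : 0 < x + s) (ht : 0 < x + t) :
    log (gammaRatioExp s t α x) = stirlingRem α (x + s) - stirlingRem α (x + t) := by
  rw [gammaRatioExp, log_mul (gammaRatio_pos hs ht).ne' (exp_pos _).ne', log_exp,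
    log_gammaRatio hs ht, trigamma_eq (by linarith), trigamma_eq (by linarith)]
  unfold stirlingRem
  ring

theorem exp_le_gammaRatio_iff (hα : 0 ≤ α) (hs : 0 < x + s) (ht : 0 < x + t) :
    exp (t - s + (trigamma (x + s + α) - trigamma (x + t + α)) / 12) ≤ gammaRatio s t x ↔
      stirlingRem α (x + t) ≤ stirlingRem α (x + s) := by
  rw [← le_log_iff_exp_le (gammaRatio_pos hs ht), ← sub_nonneg, ← sub_nonneg (a := stirlingRem _ _),
    ← log_gammaRatioExp hα hs ht, gammaRatioExp,
    log_mul (gammaRatio_pos hs ht).ne' (exp_pos _).ne', log_exp]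
  constructor <;> intro h <;> linarith

theorem gammaRatio_le_exp_iff (hα : 0 ≤ α) (hs : 0 < x + s) (ht : 0 < x + t) :
    gammaRatio s t x ≤ exp (t - s + (trigamma (x + s + α) - trigamma (x + t + α)) / 12) ↔
      stirlingRem α (x + s) ≤ stirlingRem α (x + t) := by
  rw [← log_le_iff_le_exp (gammaRatio_pos hs ht), ← sub_nonpos, ← sub_nonpos (a := stirlingRem _ _),
    ← log_gammaRatioExp hα hs ht, gammaRatioExp,
    log_mul (gammaRatio_pos hs ht).ne' (exp_pos _).ne', log_exp]
  constructor <;> intro h <;> linarith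

theorem hasDerivAt_stirlingRemIterDeriv_sub (hα : 0 ≤ α) (hs : 0 < x + s) (ht : 0 < x + t) (k : ℕ) :
    HasDerivAt (fun x => stirlingRemIterDeriv α k (x + s) - stirlingRemIterDeriv α k (x + t))
      (stirlingRemIterDeriv α (k + 1) (x + s) - stirlingRemIterDeriv α (k + 1) (x + t)) x :=
  ((hasDerivAt_stirlingRemIterDeriv hα hs k).comp_add_const x s).sub
    ((hasDerivAt_stirlingRemIterDeriv hα ht k).comp_add_const x t)

theorem isLogCompletelyMonotonicOn_gammaRatioExp_iff (hst : s < t) (hα : 0 ≤ α) :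
    IsLogCompletelyMonotonicOn (fun x => gammaRatioExp s t α x) (Ioi (-s)) ↔
      ∀ k : ℕ, 1 ≤ k → ∀ x ∈ Ioi (-s), 0 ≤ (-1 : ℝ) ^ k *
        (stirlingRemIterDeriv α k (x + s) - stirlingRemIterDeriv α k (x + t)) := by
  have hs : ∀ x ∈ Ioi (-s), 0 < x + s := fun x hx => neg_lt_iff_pos_add.1 hx
  have ht : ∀ x ∈ Ioi (-s), 0 < x + t := fun x hx => by linarith [hs x hx]
  exact isLogCompletelyMonotonicOn_Ioi_iff
    (H := fun k x => stirlingRemIterDeriv α k (x + s) - stirlingRemIterDeriv α k (x + t))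
    (fun x hx => gammaRatioExp_pos (hs x hx) (ht x hx))
    (fun x hx => log_gammaRatioExp hα (hs x hx) (ht x hx))
    fun k x hx => hasDerivAt_stirlingRemIterDeriv_sub hα (hs x hx) (ht x hx) k

theorem isLogCompletelyMonotonicOn_inv_gammaRatioExp_iff (hst : s < t) (hα : 0 ≤ α) :
    IsLogCompletelyMonotonicOn (fun x => (gammaRatioExp s t α x)⁻¹) (Ioi (-s)) ↔
      ∀ k : ℕ, 1 ≤ k → ∀ x ∈ Ioi (-s), 0 ≤ (-1 : ℝ) ^ k *
        -(stirlingRemIterDeriv α k (x + s) - stirlingRemIterDeriv α k (x + t)) := by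
  have hs : ∀ x ∈ Ioi (-s), 0 < x + s := fun x hx => neg_lt_iff_pos_add.1 hx
  have ht : ∀ x ∈ Ioi (-s), 0 < x + t := fun x hx => by linarith [hs x hx]
  exact isLogCompletelyMonotonicOn_Ioi_iff
    (H := fun k x => -(stirlingRemIterDeriv α k (x + s) - stirlingRemIterDeriv α k (x + t)))
    (fun x hx => inv_pos.2 (gammaRatioExp_pos (hs x hx) (ht x hx)))
    (fun x hx => by rw [log_inv, log_gammaRatioExp hα (hs x hx) (ht x hx)]; rfl)
    fun k x hx => (hasDerivAt_stirlingRemIterDeriv_sub hα (hs x hx) (ht x hx) k).neg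

/-- If `α > 0`, the difference of the remainders is unbounded near the left end point. -/
theorem eq_zero_of_stirlingRem_sub_le (hst : s < t) (hα : 0 ≤ α) {b c : ℝ} (hb : -s < b)
    (h : ∀ x, -s < x → x < b → stirlingRem α (x + s) - stirlingRem α (x + t) ≤ c) : α = 0 := by
  by_contra hne
  have hα' : 0 < α := lt_of_le_of_ne hα (Ne.symm hne)
  have h1 : Tendsto (fun y => -stirlingRem α (y + (t - s))) (𝓝[>] 0)
      (𝓝 (-stirlingRem α (0 + (t - s)))) :=
    (((hasDerivAt_stirlingRem hα (x := 0 + (t - s)) (by linarith)).comp_add_const 0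
      (t - s)).continuousAt.tendsto.mono_left nhdsWithin_le_nhds).neg
  have h2 := (h1.add_atTop (tendsto_stirlingRem_nhdsGT_zero hα')).eventually_gt_atTop c
  obtain ⟨y, hy, hy0, hyb⟩ := (h2.and (Ioo_mem_nhdsGT (show (0 : ℝ) < b + s by linarith))).exists
  have := h (y - s) (by linarith) (by linarith)
  rw [show y - s + s = y by ring, show y - s + t = y + (t - s) by ring] at this
  linarith

/-! ### The two equivalences and the double inequality -/

theorem mainTheorem4 (s t : ℝ) (hst : s < t) :
    (∀ α : ℝ, 0 ≤ α →
      (IsLogCompletelyMonotonicOn (fun x => gammaRatioExp s t α x) (Set.Ioi (-s)) ↔ 1 / 2 ≤ α) ∧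
      (IsLogCompletelyMonotonicOn (fun x => (gammaRatioExp s t α x)⁻¹) (Set.Ioi (-s)) ↔ α = 0)) ∧
    (∀ α β : ℝ, 0 ≤ β → β < α →
      ((∀ x ∈ Set.Ioi (-s),
          Real.exp (t - s + (trigamma (x + s + α) - trigamma (x + t + α)) / 12) ≤ gammaRatio s t x ∧
          gammaRatio s t x ≤
            Real.exp (t - s + (trigamma (x + s + β) - trigamma (x + t + β)) / 12)) ↔
        β = 0 ∧ 1 / 2 ≤ α)) := by
  have hs : ∀ x ∈ Ioi (-s), 0 < x + s := fun x hx => neg_lt_iff_pos_add.1 hx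
  have ht : ∀ x ∈ Ioi (-s), 0 < x + t := fun x hx => by linarith [hs x hx]
  refine ⟨fun α hα => ⟨?_, ?_⟩, fun α β hβ hβα => ?_⟩
  · rw [isLogCompletelyMonotonicOn_gammaRatioExp_iff hst hα]
    refine ⟨fun h => ?_, fun h k hk x hx => ?_⟩
    · by_contra! hα'
      obtain ⟨a, ha, hanti, -⟩ := exists_strictAntiOn_strictMonoOn_stirlingRem hα hα'
      -- At `x = a + 1 - s` both `x + s = a + 1` and `x + t` exceed `a`, so order one already
      -- contradicts strict decrease.
      have h1 := h 1 le_rfl (a + 1 - s) (by simp only [mem_Ioi]; linarith)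
      have h2 := hanti (a := a + 1 - s + s) (b := a + 1 - s + t) (by simp only [mem_Ioi]; linarith)
        (by simp only [mem_Ioi]; linarith) (by linarith)
      simp only [stirlingRemIterDeriv] at h1
      linarith
    · rw [mul_sub, sub_nonneg]
      exact antitoneOn_neg_one_pow_mul_stirlingRemIterDeriv h hk (hs x hx) (ht x hx) (by linarith)
  · rw [isLogCompletelyMonotonicOn_inv_gammaRatioExp_iff hst hα]
    refine ⟨fun h => ?_, ?_⟩
    -- Order one makes the difference of remainders increasing, hence bounded above on `(-s, -s +
    -- 1)` by its value at `-s + 1`.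
    · have hmono := monotoneOn_Ioi_of_hasDerivAt
        (fun x hx => hasDerivAt_stirlingRemIterDeriv_sub hα (hs x hx) (ht x hx) 0)
        fun x hx => by simpa using h 1 le_rfl x hx
      refine eq_zero_of_stirlingRem_sub_le hst hα (b := -s + 1) (by linarith) fun x hx hxb =>
        hmono hx (show -s < -s + 1 by linarith) hxb.le
    · rintro rfl k hk x hx
      have := monotoneOn_neg_one_pow_mul_stirlingRemIterDeriv hk (hs x hx) (ht x hx) (by linarith)
      simp only at this
      linarith
  · have hα : 0 ≤ α := by linarith
    refine ⟨fun h => ⟨?_, ?_⟩, ?_⟩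
    · refine eq_zero_of_stirlingRem_sub_le hst hβ (b := -s + 1) (c := 0) (by linarith)
        fun x hx _ => ?_
      have := (gammaRatio_le_exp_iff hβ (hs x hx) (ht x hx)).1 (h x hx).2
      linarith
    · by_contra! hα'
      obtain ⟨a, ha, -, hmono⟩ := exists_strictAntiOn_strictMonoOn_stirlingRem hα hα'
      have hx : a + 1 - s ∈ Ioi (-s) := by simp only [mem_Ioi]; linarith
      have h1 := (exp_le_gammaRatio_iff hα (hs _ hx) (ht _ hx)).1 (h _ hx).1
      have h2 := hmono (a := a + 1 - s + s) (b := a + 1 - s + t) (by simp only [mem_Ioi]; linarith)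
        (by simp only [mem_Ioi]; linarith) (by linarith)
      linarith
    · rintro ⟨rfl, hα'⟩ x hx
      rw [exp_le_gammaRatio_iff hα (hs x hx) (ht x hx),
        gammaRatio_le_exp_iff le_rfl (hs x hx) (ht x hx)]
      exact ⟨antitoneOn_stirlingRem hα' (hs x hx) (ht x hx) (by linarith),
        monotoneOn_stirlingRem_zero (hs x hx) (ht x hx) (by linarith)⟩
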